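/- Let $\mathbb D=\{z\in\mathbb C:|z|<1\}$ and $\phi(z)=1+\frac{4z}{3}+\frac{2z^2}{3}$. Let $\mathcal S^*_C=\mathcal S^*(\phi)$ be the class of functions $f$ that are analytic and univalent in $\mathbb D$, normalized by $f(0)=0$ and $f'(0)=1$, and such that $zf'(z)/f(z)\prec\phi(z)$; that is, there is an analytic function $\omega:\mathbb D\to\mathbb D$ with $\omega(0)=0$ and $zf'(z)/f(z)=\phi(\omega(z))$ for $z\in\mathbb D$ (where the quotient is given its limit value $1$ at $z=0$). The equation $r\exp\left(\frac{4r}{3}+\frac{r^2}{3}\right)=e^{-1}$ has a smallest root $r_f$ in $(0,1)$, and $0<r_f<\frac13$. For every $f(z)=z+\sum_{n=2}^\infty a_nz^n$ in $\mathcal S^*_C$ the Bohr inequality $$|z|+\sum_{n=2}^{\infty}|a_n||z|^n\le d\bigl(f(0),\partial f(\mathbb D)\bigr)$$ holds for all $z$ with $|z|\le r_f$, where $d$ is the Euclidean distance. The radius $r_f$ is best possible: for every $\rho\in(r_f,1)$ there are $f\in\mathcal S^*_C$ and $z$ with $|z|=\rho$ for which this inequality fails. -/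

import Mathlib

/-- `p ≺ q` in the open unit disk: `p(z) = q(ω(z))` for `|z| < 1`, with `ω` an analytic self-map of
the open unit disk such that `ω(0) = 0`. -/
def Subordinate (p q : ℂ → ℂ) : Prop :=
  ∃ ω : ℂ → ℂ, DifferentiableOn ℂ ω (Metric.ball 0 1) ∧
    Set.MapsTo ω (Metric.ball 0 1) (Metric.ball 0 1) ∧ ω 0 = 0 ∧
    ∀ z ∈ Metric.ball (0 : ℂ) 1, p z = q (ω z)

/-- The class `𝓢` of normalized univalent functions in the open unit disk. Functions are total on
`ℂ`, and only their restriction to the open unit disk matters. -/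
def classS : Set (ℂ → ℂ) :=
  {f | DifferentiableOn ℂ f (Metric.ball 0 1) ∧ f 0 = 0 ∧ deriv f 0 = 1 ∧
    Set.InjOn f (Metric.ball 0 1)}

/-- The function `z f'(z) / f(z)`, with its removable singularity at `0` filled in by the limit `1`
(for `f` with `f(0) = 0` and `f'(0) = 1`). -/
noncomputable def starlikeQuotient (f : ℂ → ℂ) (z : ℂ) : ℂ :=
  if z = 0 then 1 else z * deriv f z / f z

/-- The Ma-Minda class `𝓢*(φ)`: functions `f ∈ 𝓢` such that `z f'(z) / f(z) ≺ φ(z)`. -/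
def starlikeClass (φ : ℂ → ℂ) : Set (ℂ → ℂ) :=
  {f | f ∈ classS ∧ Subordinate (starlikeQuotient f) φ}

/-- The cardioid class `𝓢*_C = 𝓢*(1 + 4z/3 + 2z²/3)`. -/
def cardioidClass : Set (ℂ → ℂ) :=
  starlikeClass (fun z => 1 + 4 * z / 3 + 2 * z ^ 2 / 3)

/-- The `n`-th Taylor coefficient of `f` at `0`. -/
noncomputable def taylorCoeff (f : ℂ → ℂ) (n : ℕ) : ℂ :=
  iteratedDeriv n f 0 / (n.factorial : ℂ)

/-- The Bohr inequality at `z` for a normalized `f(z) = z + ∑_{n ≥ 2} aₙ zⁿ`: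
`|z| + ∑_{n ≥ 2} |aₙ| |z|ⁿ ≤ d(f(0), ∂f(𝔻))`. Both sides are taken in `[0, ∞]`, so that neither the
series nor the distance has a junk value. -/
def BohrInequality (f : ℂ → ℂ) (z : ℂ) : Prop :=
  ‖z‖ₑ + ∑' n : ℕ, ‖taylorCoeff f (n + 2)‖ₑ * ‖z‖ₑ ^ (n + 2) ≤
    Metric.infEDist (f 0) (frontier (f '' Metric.ball 0 1))

/-! Both sides of the inequality are compared with `k(z) = z exp(4z/3 + z²/3)`, for which `z k'/k =
φ`.

Left side: write `z f'/f = 1 + p` with `p = 4ω/3 + 2ω²/3`. Bohr's classical theorem (radius `1/3`)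
applied to `ω(z)/z` bounds the majorant series of `ω` at `t ≤ 1/3` by `t`, hence that of `p` by
`4t/3 + 2t²/3`. The coefficient recursion for `f` turns this into a differential inequality for the
majorant series of `f(z)/z`, which integrates to the bound `exp(4t/3 + t²/3)`
(`cardioid_coeff_majorant`). So the Bohr sum is at most `k(|z|)` when `|z| ≤ 1/3`, and `r_f < 1/3`
makes this enough.

Right side: by Jack's lemma `log(f(z)/z)` takes values `4u/3 + u²/3` with `|u| ≤ |z|`. Their real
part is at least `-1`, so `|f(z)| ≥ |z|/e` and the image of the disk has boundary at distance at
least `1/e` (`norm_mul_exp_neg_one_le`, `le_infEDist_frontier_image_ball`).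

Sharpness: `k` is in the class, `k(-1) = -1/e` is a boundary point of its image, and its Bohr sum at
`ρ > r_f` is at least `k(ρ) > k(r_f) = 1/e`. -/

open Complex Metric in
theorem exists_norm_eq_one_norm_add_mul (a c : ℂ) :
    ∃ l : ℂ, ‖l‖ = 1 ∧ ‖a + l * c‖ = ‖a‖ + ‖c‖ := by
  refine ⟨exp ((arg a - arg c : ℝ) * I), norm_exp_ofReal_mul_I _, ?_⟩
  have h : a + exp ((arg a - arg c : ℝ) * I) * c = ((‖a‖ + ‖c‖ : ℝ) : ℂ) * exp (arg a * I) := by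
    have h2 : exp ((arg a - arg c : ℝ) * I) * exp (arg c * I) = exp (arg a * I) := by
      rw [← exp_add]; congr 1; push_cast; ring
    rw [ofReal_add]
    linear_combination (‖c‖ : ℂ) * h2 - norm_mul_exp_arg_mul_I a -
      exp ((arg a - arg c : ℝ) * I) * norm_mul_exp_arg_mul_I c
  rw [h, norm_mul, norm_exp_ofReal_mul_I, mul_one, Complex.norm_real, Real.norm_of_nonneg (by positivity)]

/-! ### Algebra of Taylor coefficients -/

theorem taylorCoeff_mul {f g : ℂ → ℂ} (hf : AnalyticAt ℂ f 0) (hg : AnalyticAt ℂ g 0) (n : ℕ) :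
    taylorCoeff (fun z => f z * g z) n =
      ∑ i ∈ Finset.range (n + 1), taylorCoeff f i * taylorCoeff g (n - i) := by
  unfold taylorCoeff
  rw [iteratedDeriv_fun_mul hf.contDiffAt hg.contDiffAt, Finset.sum_div]
  refine Finset.sum_congr rfl fun i hi => ?_
  have hi' : i ≤ n := by simpa [Nat.lt_succ_iff] using hi
  have := Nat.choose_mul_factorial_mul_factorial hi'
  have h2 : ((n.choose i : ℂ)) * (i.factorial : ℂ) * ((n - i).factorial : ℂ) = (n.factorial : ℂ) := by
    exact_mod_cast this
  have h3 : (i.factorial : ℂ) ≠ 0 := by exact_mod_cast i.factorial_ne_zero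
  have h4 : ((n-i).factorial : ℂ) ≠ 0 := by exact_mod_cast (n-i).factorial_ne_zero
  have h5 : (n.factorial : ℂ) ≠ 0 := by exact_mod_cast n.factorial_ne_zero
  field_simp
  rw [← h2]; ring

theorem taylorCoeff_id (n : ℕ) : taylorCoeff (fun z => z) n = if n = 1 then 1 else 0 := by
  unfold taylorCoeff
  rcases n with _ | _ | n
  · simp
  · simp [iteratedDeriv_succ]
  · have : iteratedDeriv (n + 2) (fun z : ℂ => z) = fun _ => 0 := by
      rw [iteratedDeriv_succ', iteratedDeriv_succ']
      ext x
      simp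
    simp [this]

theorem taylorCoeff_id_mul_succ {f : ℂ → ℂ} (hf : AnalyticAt ℂ f 0) (n : ℕ) :
    taylorCoeff (fun z => z * f z) (n + 1) = taylorCoeff f n := by
  rw [taylorCoeff_mul (f := fun z => z) analyticAt_id hf, Finset.sum_eq_single 1]
  · simp [taylorCoeff_id]
  · intro b _ hb; simp [taylorCoeff_id, hb]
  · intro h; simp at h

theorem taylorCoeff_deriv (f : ℂ → ℂ) (n : ℕ) :
    taylorCoeff (deriv f) n = (n + 1) * taylorCoeff f (n + 1) := by
  unfold taylorCoeff
  rw [iteratedDeriv_succ', Nat.factorial_succ]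
  have h5 : (n.factorial : ℂ) ≠ 0 := by exact_mod_cast n.factorial_ne_zero
  have h6 : (n : ℂ) + 1 ≠ 0 := by exact_mod_cast n.succ_ne_zero
  push_cast
  field_simp

theorem taylorCoeff_congr {f g : ℂ → ℂ} (h : f =ᶠ[nhds 0] g) (n : ℕ) :
    taylorCoeff f n = taylorCoeff g n := by
  unfold taylorCoeff; rw [h.iteratedDeriv_eq]

/-! ### Bohr's theorem for bounded functions -/

open Real in
theorem circleAverage_inv_pow_mul {f : ℂ → ℂ} {r : ℝ} (hr : 0 < r)
    (hf : DifferentiableOn ℂ f (Metric.closedBall 0 r)) (n : ℕ) :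
    circleAverage (fun z => (z ^ n)⁻¹ * f z) 0 r = taylorCoeff f n := by
  rw [circleAverage_eq_circleIntegral hr.ne']
  have := hf.circleIntegral_one_div_sub_center_pow_smul hr n
  have h2 : (∮ z in C(0, r), (z - 0)⁻¹ • ((z ^ n)⁻¹ * f z)) =
     ∮ z in C(0, r), (1 / (z - 0) ^ (n + 1)) • f z := by
    congr 1; ext z; simp [pow_succ]; ring
  rw [h2, this, taylorCoeff]
  have h5 : (n.factorial : ℂ) ≠ 0 := by exact_mod_cast n.factorial_ne_zero
  have := Real.pi_pos.ne'
  simp only [smul_eq_mul]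
  have : (π : ℂ) ≠ 0 := by exact_mod_cast this
  field_simp

-- The kernel `1 + Re(m zⁿ)` with `|m| = r⁻ⁿ` is nonnegative with mean `1` on `|z| = r`, so
-- averaging `f` against it gives a number of modulus at most `1`. That average is `a₀ + l aₙ rⁿ /
-- 2`, and the unimodular `l` is chosen to align the two terms.
open Real in
theorem norm_coeff_zero_add_le {f : ℂ → ℂ} {r : ℝ} (hr : 0 < r)
    (hf : DifferentiableOn ℂ f (Metric.closedBall 0 r))
    (hb : ∀ z ∈ Metric.closedBall 0 r, ‖f z‖ ≤ 1) {n : ℕ} (hn : n ≠ 0) :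
    ‖taylorCoeff f 0‖ + ‖taylorCoeff f n‖ * r ^ n / 2 ≤ 1 := by
  obtain ⟨l, hl, hl2⟩ := exists_norm_eq_one_norm_add_mul (taylorCoeff f 0) (taylorCoeff f n * r ^ n / 2)
  have hcont : ContinuousOn f (Metric.sphere 0 r) := hf.continuousOn.mono Metric.sphere_subset_closedBall
  have hne : ∀ z ∈ Metric.sphere (0:ℂ) r, z ^ n ≠ 0 := by
    intro z hz h0
    have : z = 0 := by simpa [hn] using h0
    simp [this] at hz; linarith
  set m : ℂ := (starRingEnd ℂ) l / r ^ n with hm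
  have A0 : circleAverage f 0 r = taylorCoeff f 0 := by
    have := circleAverage_inv_pow_mul hr hf 0
    simpa using this
  have A1 : circleAverage (fun z => (m/2) • (z ^ n * f z)) 0 r = 0 := by
    rw [circleAverage_fun_smul]
    have : DiffContOnCl ℂ (fun z => z ^ n * f z) (Metric.ball 0 |r|) := by
      rw [abs_of_pos hr]
      apply DifferentiableOn.diffContOnCl
      rw [closure_ball _ hr.ne']
      exact (differentiableOn_id.pow n).mul hf
    rw [this.circleAverage]; simp [hn]
  have A2 : circleAverage (fun z => (l * r ^ n / 2) • ((z ^ n)⁻¹ * f z)) 0 r =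
      (l * r ^ n / 2) * taylorCoeff f n := by
    rw [circleAverage_fun_smul, circleAverage_inv_pow_mul hr hf, smul_eq_mul]
  have I0 : CircleIntegrable f 0 r := hcont.circleIntegrable hr.le
  have I1 : CircleIntegrable (fun z => (m/2) • (z ^ n * f z)) 0 r := by
    apply ContinuousOn.circleIntegrable hr.le
    have : ContinuousOn (fun z => z ^ n * f z) (Metric.sphere 0 r) :=
      (continuousOn_id.pow n).mul hcont
    exact this.const_smul (m / 2)
  have I2 : CircleIntegrable (fun z => (l * r ^ n / 2) • ((z ^ n)⁻¹ * f z)) 0 r := by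
    apply ContinuousOn.circleIntegrable hr.le
    have : ContinuousOn (fun z => (z ^ n)⁻¹ * f z) (Metric.sphere 0 r) :=
      ((continuousOn_id.pow n).inv₀ hne).mul hcont
    exact this.const_smul (l * r ^ n / 2)
  have key : circleAverage (fun z => f z + (m/2) • (z ^ n * f z) + (l * r ^ n / 2) • ((z ^ n)⁻¹ * f z)) 0 r
      = taylorCoeff f 0 + l * (taylorCoeff f n * r ^ n / 2) := by
    have I01 : CircleIntegrable (fun z => f z + (m/2) • (z ^ n * f z)) 0 r := I0.add I1
    rw [circleAverage_fun_add I01 I2, circleAverage_fun_add I0 I1, A0, A1, A2]; ring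
  have hK : circleAverage (fun z => (1 + m * z ^ n).re) 0 r = 1 := by
    have hd : Differentiable ℂ (fun z : ℂ => 1 + m * z ^ n) := by fun_prop
    have h1 := Complex.reCLM.circleAverage_comp_comm (c := 0) (R := r) (f := fun z : ℂ => 1 + m * z ^ n)
      (hd.continuous.continuousOn.circleIntegrable hr.le)
    have h2 : circleAverage (fun z : ℂ => 1 + m * z ^ n) 0 r = 1 := by
      rw [hd.diffContOnCl.circleAverage]; simp [hn]
    rw [h2] at h1
    simpa [Function.comp_def] using h1
  have hle : ‖circleAverage (fun z => f z + (m/2) • (z ^ n * f z) + (l * r ^ n / 2) • ((z ^ n)⁻¹ * f z)) 0 r‖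
      ≤ circleAverage (fun z => (1 + m * z ^ n).re) 0 r := by
    rw [circleAverage_def, circleAverage_def, norm_smul, smul_eq_mul]
    have hp : (0:ℝ) ≤ (2 * π)⁻¹ := by positivity
    rw [Real.norm_of_nonneg hp]
    gcongr
    apply intervalIntegral.norm_integral_le_of_norm_le (by positivity)
    · refine Filter.Eventually.of_forall fun θ _ => ?_
      have hz : circleMap 0 r θ ∈ Metric.sphere (0:ℂ) r := circleMap_mem_sphere 0 hr.le θ
      generalize circleMap 0 r θ = z at hz
      have hz0 := hne z hz
      have hzn : ‖z ^ n‖ = r ^ n := by rw [norm_pow]; congr 1; simpa using hz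
      set w := z ^ n
      have hrn : (r ^ n : ℂ) ≠ 0 := by exact_mod_cast (pow_pos hr n).ne'
      have hww : w⁻¹ = (starRingEnd ℂ) w / (r ^ n) ^ 2 := by
        rw [Complex.inv_def, Complex.normSq_eq_norm_sq, hzn]; push_cast; rfl
      have hmw : ‖m * w‖ = 1 := by
        rw [norm_mul, hzn, hm, norm_div, RCLike.norm_conj, hl, norm_pow, Complex.norm_real, Real.norm_of_nonneg hr.le]
        field_simp
      -- On `|z| = r` the conjugate of `m zⁿ` is `l rⁿ z⁻ⁿ`, so the three terms are `f` times the
      -- real kernel.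
      have e : f z + (m/2) • (w * f z) + (l * r ^ n / 2) • (w⁻¹ * f z) = ((1 + m * w).re : ℂ) * f z := by
        have : ((1 + m * w).re : ℂ) = 1 + (m * w + (starRingEnd ℂ) (m * w)) / 2 := by
          rw [Complex.add_conj]; simp
        rw [this, map_mul, hww, hm]
        simp only [smul_eq_mul, map_div₀, Complex.conj_conj, map_pow, Complex.conj_ofReal]
        field_simp
        ring
      rw [e, norm_mul, Complex.norm_real, Real.norm_of_nonneg]
      · have h1 : 0 ≤ (1 + m * w).re := by
          have := (abs_le.mp ((Complex.abs_re_le_norm (m*w)).trans hmw.le)).1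
          simp; linarith [Complex.mul_re m w]
        exact mul_le_of_le_one_right h1 (hb z (Metric.sphere_subset_closedBall hz))
      · have := (abs_le.mp ((Complex.abs_re_le_norm (m*w)).trans hmw.le)).1
        simp; linarith [Complex.mul_re m w]
    · have : Continuous (fun z : ℂ => (1 + m * z ^ n).re) := by fun_prop
      exact (this.comp (continuous_circleMap 0 r)).intervalIntegrable _ _
  rw [key, hK, hl2] at hle
  have : ‖taylorCoeff f n * (r:ℂ) ^ n / 2‖ = ‖taylorCoeff f n‖ * r ^ n / 2 := by
    simp [abs_of_pos hr]
  rwa [this] at hle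

theorem norm_taylorCoeff_le_of_bounded {f : ℂ → ℂ} (hf : DifferentiableOn ℂ f (Metric.ball 0 1))
    (hb : ∀ z ∈ Metric.ball 0 1, ‖f z‖ ≤ 1) {n : ℕ} (hn : n ≠ 0) :
    ‖taylorCoeff f n‖ ≤ 2 * (1 - ‖taylorCoeff f 0‖) := by
  have hev : ∀ᶠ r : ℝ in nhdsWithin 1 (Set.Iio 1),
      ‖taylorCoeff f 0‖ + ‖taylorCoeff f n‖ * r ^ n / 2 ≤ 1 := by
    filter_upwards [Ioo_mem_nhdsLT (zero_lt_one' ℝ)] with r hr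
    have hs : Metric.closedBall (0:ℂ) r ⊆ Metric.ball 0 1 := Metric.closedBall_subset_ball hr.2
    exact norm_coeff_zero_add_le hr.1 (hf.mono hs) (fun z hz => hb z (hs hz)) hn
  have hc : Continuous (fun r : ℝ => ‖taylorCoeff f 0‖ + ‖taylorCoeff f n‖ * r ^ n / 2) := by fun_prop
  have := le_of_tendsto (hc.continuousAt.tendsto.mono_left nhdsWithin_le_nhds) hev
  simp at this
  linarith

/-- With `|aₙ| ≤ 2(1 - |a₀|)` and `∑_{n ≥ 1} 3⁻ⁿ = 1/2` the sum is at most `|a₀| + (1 - |a₀|)`. -/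
theorem bohr_sum_le_one {f : ℂ → ℂ} (hf : DifferentiableOn ℂ f (Metric.ball 0 1))
    (hb : ∀ z ∈ Metric.ball 0 1, ‖f z‖ ≤ 1) {t : ℝ} (ht0 : 0 ≤ t) (ht : t ≤ 1 / 3) (N : ℕ) :
    ∑ k ∈ Finset.range N, ‖taylorCoeff f k‖ * t ^ k ≤ 1 := by
  have h0 : ‖taylorCoeff f 0‖ ≤ 1 := by simpa [taylorCoeff] using hb 0 (by simp)
  have hgeo : ∀ M : ℕ, ∑ k ∈ Finset.range M, (1 / 3 : ℝ) ^ (k + 1) ≤ 1 / 2 := by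
    intro M
    have : ∀ M : ℕ, ∑ k ∈ Finset.range M, (1 / 3 : ℝ) ^ (k + 1) = 1 / 2 - (1/3) ^ M / 2 := by
      intro M
      induction M with
      | zero => simp
      | succ M ih => rw [Finset.sum_range_succ, ih]; ring
    rw [this]; have : (0:ℝ) ≤ (1/3) ^ M := by positivity
    linarith
  rcases N with _ | N
  · simp
  rw [Finset.sum_range_succ']
  have : ∑ k ∈ Finset.range N, ‖taylorCoeff f (k + 1)‖ * t ^ (k + 1) ≤
      ∑ k ∈ Finset.range N, 2 * (1 - ‖taylorCoeff f 0‖) * (1 / 3 : ℝ) ^ (k + 1) := by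
    refine Finset.sum_le_sum fun k _ => ?_
    exact mul_le_mul (norm_taylorCoeff_le_of_bounded hf hb k.succ_ne_zero)
      (pow_le_pow_left₀ ht0 ht _) (by positivity) (by linarith)
  rw [← Finset.mul_sum] at this
  have h2 := mul_le_mul_of_nonneg_left (hgeo N) (show 0 ≤ 2 * (1 - ‖taylorCoeff f 0‖) by linarith)
  simp only [pow_zero, mul_one]
  linarith

/-! ### Coefficient majorants on `[0, 1/3]` -/

/-- By the Schwarz lemma `w(z)/z`, realized as `dslope w 0`, is bounded by `1`. Bohr's theorem
applies to it, and the factor `z` contributes `t`. -/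
theorem schwarz_coeff_sum_le {w : ℂ → ℂ} (hw : DifferentiableOn ℂ w (Metric.ball 0 1))
    (hm : Set.MapsTo w (Metric.ball 0 1) (Metric.ball 0 1)) (h0 : w 0 = 0)
    {t : ℝ} (ht0 : 0 ≤ t) (ht : t ≤ 1 / 3) (N : ℕ) :
    ∑ k ∈ Finset.range N, ‖taylorCoeff w k‖ * t ^ k ≤ t := by
  have hb : Metric.ball (0:ℂ) 1 ∈ nhds (0:ℂ) := Metric.ball_mem_nhds _ one_pos
  have hd : DifferentiableOn ℂ (dslope w 0) (Metric.ball 0 1) :=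
    (Complex.differentiableOn_dslope hb).mpr hw
  have hbd : ∀ z ∈ Metric.ball (0:ℂ) 1, ‖dslope w 0 z‖ ≤ 1 := by
    intro z hz
    have := Complex.norm_dslope_le_div_of_mapsTo_ball (R₂ := 1) hw
      (by rw [h0]; exact hm.mono_right Metric.ball_subset_closedBall) hz
    simpa using this
  have he : w = fun z => z * dslope w 0 z := by
    ext z
    have := sub_smul_dslope w 0 z
    simp [h0] at this
    exact this.symm
  rcases N with _ | N
  · simpa
  rw [Finset.sum_range_succ']
  have : ∀ k, taylorCoeff w (k + 1) = taylorCoeff (dslope w 0) k := by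
    intro k
    conv_lhs => rw [he]
    exact taylorCoeff_id_mul_succ (hd.analyticAt hb) k
  have hz : taylorCoeff w 0 = 0 := by simp [taylorCoeff, h0]
  simp only [this, hz, norm_zero, zero_mul, add_zero, pow_succ, ← mul_assoc]
  rw [← Finset.sum_mul]
  exact mul_le_of_le_one_left ht0 (bohr_sum_le_one hd hbd ht0 ht N)

/-- The truncated Cauchy product omits only nonnegative terms of the product of the truncations.
This lets all majorants be handled as polynomials, with no convergence question. -/
theorem sum_range_conv_le_mul_sum {u v : ℕ → ℝ} (hu : ∀ n, 0 ≤ u n) (hv : ∀ n, 0 ≤ v n) (N : ℕ) :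
    ∑ m ∈ Finset.range N, ∑ k ∈ Finset.range (m + 1), u k * v (m - k) ≤
      (∑ k ∈ Finset.range N, u k) * ∑ k ∈ Finset.range N, v k := by
  rw [Finset.sum_range_diag_flip N (fun a b => u a * v b), Finset.sum_mul]
  refine Finset.sum_le_sum fun i _ => ?_
  rw [← Finset.mul_sum]
  exact mul_le_mul_of_nonneg_left
    (Finset.sum_le_sum_of_subset_of_nonneg (Finset.range_mono (Nat.sub_le _ _))
      fun j _ _ => hv j) (hu i)

theorem taylorCoeff_add {f g : ℂ → ℂ} (hf : AnalyticAt ℂ f 0) (hg : AnalyticAt ℂ g 0) (n : ℕ) :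
    taylorCoeff (fun z => f z + g z) n = taylorCoeff f n + taylorCoeff g n := by
  unfold taylorCoeff
  rw [iteratedDeriv_fun_add hf.contDiffAt hg.contDiffAt, add_div]

theorem taylorCoeff_const_mul (c : ℂ) (f : ℂ → ℂ) (n : ℕ) :
    taylorCoeff (fun z => c * f z) n = c * taylorCoeff f n := by
  unfold taylorCoeff
  rw [iteratedDeriv_const_mul_field, mul_div_assoc]

theorem norm_taylorCoeff_mul_le {f g : ℂ → ℂ} (hf : AnalyticAt ℂ f 0) (hg : AnalyticAt ℂ g 0)
    {t : ℝ} (ht : 0 ≤ t) (n : ℕ) :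
    ‖taylorCoeff (fun z => f z * g z) n‖ * t ^ n ≤
      ∑ i ∈ Finset.range (n + 1),
        (‖taylorCoeff f i‖ * t ^ i) * (‖taylorCoeff g (n - i)‖ * t ^ (n - i)) := by
  rw [taylorCoeff_mul hf hg]
  calc _ ≤ (∑ i ∈ Finset.range (n + 1), ‖taylorCoeff f i * taylorCoeff g (n - i)‖) * t ^ n := by
        gcongr; exact norm_sum_le _ _
    _ = _ := by
        rw [Finset.sum_mul]
        refine Finset.sum_congr rfl fun i hi => ?_
        have hi' : i ≤ n := by simpa [Nat.lt_succ_iff] using hi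
        rw [norm_mul]
        rw [← pow_mul_pow_sub t hi']; ring

theorem cardioid_coeff_sum_le {w : ℂ → ℂ} (hw : DifferentiableOn ℂ w (Metric.ball 0 1))
    (hm : Set.MapsTo w (Metric.ball 0 1) (Metric.ball 0 1)) (h0 : w 0 = 0)
    {t : ℝ} (ht0 : 0 ≤ t) (ht : t ≤ 1 / 3) (N : ℕ) :
    ∑ k ∈ Finset.range N, ‖taylorCoeff (fun z => 4 / 3 * w z + 2 / 3 * (w z * w z)) k‖ * t ^ k ≤
      4 / 3 * t + 2 / 3 * t ^ 2 := by
  have ha : AnalyticAt ℂ w 0 := hw.analyticAt (Metric.ball_mem_nhds _ one_pos)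
  have hs := schwarz_coeff_sum_le hw hm h0 ht0 ht N
  set W := ∑ k ∈ Finset.range N, ‖taylorCoeff w k‖ * t ^ k with hW
  have hW0 : 0 ≤ W := Finset.sum_nonneg fun _ _ => by positivity
  have hle : ∀ k, ‖taylorCoeff (fun z => 4 / 3 * w z + 2 / 3 * (w z * w z)) k‖ * t ^ k ≤
      4 / 3 * (‖taylorCoeff w k‖ * t ^ k) + 2 / 3 * ∑ i ∈ Finset.range (k + 1),
        (‖taylorCoeff w i‖ * t ^ i) * (‖taylorCoeff w (k - i)‖ * t ^ (k - i)) := by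
    intro k
    rw [taylorCoeff_add (analyticAt_const.fun_mul ha) (analyticAt_const.fun_mul (ha.fun_mul ha)),
      taylorCoeff_const_mul, taylorCoeff_const_mul]
    have h1 := norm_taylorCoeff_mul_le ha ha ht0 k
    have h2 := norm_add_le (4 / 3 * taylorCoeff w k) (2 / 3 * taylorCoeff (fun z => w z * w z) k)
    rw [norm_mul, norm_mul] at h2
    norm_num at h2
    have h3 := mul_le_mul_of_nonneg_right h2 (pow_nonneg ht0 k)
    linarith
  have h4 := Finset.sum_le_sum fun k (_ : k ∈ Finset.range N) => hle k
  rw [Finset.sum_add_distrib, ← Finset.mul_sum, ← Finset.mul_sum, ← hW] at h4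
  have h5 := sum_range_conv_le_mul_sum (u := fun k => ‖taylorCoeff w k‖ * t ^ k)
    (v := fun k => ‖taylorCoeff w k‖ * t ^ k) (fun _ => by positivity) (fun _ => by positivity) N
  rw [← hW] at h5
  nlinarith

theorem norm_taylorCoeff_recursion {f p : ℂ → ℂ} (hf : AnalyticAt ℂ f 0) (hp : AnalyticAt ℂ p 0)
    (hf0 : f 0 = 0) (heq : (fun z => z * deriv f z) =ᶠ[nhds 0] fun z => f z + p z * f z)
    {t : ℝ} (ht : 0 ≤ t) (m : ℕ) :
    m * ‖taylorCoeff f (m + 1)‖ * t ^ m ≤ ∑ i ∈ Finset.range (m + 1),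
      (‖taylorCoeff p i‖ * t ^ i) * (‖taylorCoeff f (m - i + 1)‖ * t ^ (m - i)) := by
  have h1 := taylorCoeff_congr heq (m + 1)
  rw [taylorCoeff_id_mul_succ hf.deriv, taylorCoeff_deriv, taylorCoeff_add hf (hp.fun_mul hf),
    taylorCoeff_mul hp hf, Finset.sum_range_succ] at h1
  have hz : taylorCoeff f 0 = 0 := by simp [taylorCoeff, hf0]
  rw [Nat.sub_self, hz, mul_zero, add_zero] at h1
  have h2 : (m : ℂ) * taylorCoeff f (m + 1) =
      ∑ i ∈ Finset.range (m + 1), taylorCoeff p i * taylorCoeff f (m + 1 - i) := by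
    linear_combination h1
  have h3 : (m : ℝ) * ‖taylorCoeff f (m + 1)‖ = ‖(m : ℂ) * taylorCoeff f (m + 1)‖ := by
    rw [norm_mul, Complex.norm_natCast]
  rw [h3, h2]
  calc _ ≤ (∑ i ∈ Finset.range (m + 1), ‖taylorCoeff p i * taylorCoeff f (m + 1 - i)‖) * t ^ m := by
        gcongr; exact norm_sum_le _ _
    _ = _ := by
        rw [Finset.sum_mul]
        refine Finset.sum_congr rfl fun i hi => ?_
        have hi' : i ≤ m := by simpa [Nat.lt_succ_iff] using hi
        rw [norm_mul, Nat.sub_add_comm hi']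
        rw [← pow_mul_pow_sub t hi']; ring

/-- A Grönwall argument: the recursion gives `s T'(s) ≤ (4s/3 + 2s²/3) T(s)` for the truncated
majorant `T` of `f(z)/z`, so `T(s) exp(-(4s/3 + s²/3))` decreases from a value at most `1`. -/
theorem cardioid_coeff_majorant {f w : ℂ → ℂ} (hf : DifferentiableOn ℂ f (Metric.ball 0 1))
    (hf0 : f 0 = 0) (hf1 : deriv f 0 = 1) (hw : DifferentiableOn ℂ w (Metric.ball 0 1))
    (hm : Set.MapsTo w (Metric.ball 0 1) (Metric.ball 0 1)) (h0 : w 0 = 0)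
    (heq : ∀ z ∈ Metric.ball (0 : ℂ) 1,
      z * deriv f z = f z + (4 / 3 * w z + 2 / 3 * (w z * w z)) * f z)
    {t : ℝ} (ht0 : 0 ≤ t) (ht : t ≤ 1 / 3) (N : ℕ) :
    ∑ n ∈ Finset.range N, ‖taylorCoeff f (n + 1)‖ * t ^ n ≤ Real.exp (4 * t / 3 + t ^ 2 / 3) := by
  have hb : Metric.ball (0 : ℂ) 1 ∈ nhds 0 := Metric.ball_mem_nhds _ one_pos
  have hfa := hf.analyticAt hb
  have hwa := hw.analyticAt hb
  have hpa : AnalyticAt ℂ (fun z => 4 / 3 * w z + 2 / 3 * (w z * w z)) 0 :=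
    (analyticAt_const.mul hwa).add (analyticAt_const.mul (hwa.mul hwa))
  have heq' := Filter.eventually_of_mem hb heq
  set T : ℝ → ℝ := fun t => ∑ n ∈ Finset.range N, ‖taylorCoeff f (n + 1)‖ * t ^ n with hT
  set T' : ℝ → ℝ := fun t => ∑ n ∈ Finset.range N, ‖taylorCoeff f (n + 1)‖ * (n * t ^ (n - 1)) with hT'
  have hd : ∀ s, HasDerivAt T (T' s) s := fun s =>
    HasDerivAt.fun_sum fun n _ => (hasDerivAt_pow n s).const_mul _
  have hineq : ∀ s, 0 < s → s ≤ 1 / 3 → T' s ≤ (4 / 3 + 2 / 3 * s) * T s := by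
    intro s hs hs3
    have h1 : s * T' s ≤ (4 / 3 * s + 2 / 3 * s ^ 2) * T s := by
      calc s * T' s = ∑ m ∈ Finset.range N, m * ‖taylorCoeff f (m + 1)‖ * s ^ m := by
            rw [hT', Finset.mul_sum]
            refine Finset.sum_congr rfl fun n _ => ?_
            rcases n with _ | n
            · simp
            · simp only [Nat.add_sub_cancel, pow_succ]; ring
        _ ≤ _ := Finset.sum_le_sum fun m _ =>
              norm_taylorCoeff_recursion hfa hpa hf0 heq' hs.le m
        _ ≤ _ := sum_range_conv_le_mul_sum
              (u := fun k => ‖taylorCoeff (fun z => 4 / 3 * w z + 2 / 3 * (w z * w z)) k‖ * s ^ k)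
              (v := fun k => ‖taylorCoeff f (k + 1)‖ * s ^ k)
              (fun _ => by positivity) (fun _ => by positivity) N
        _ ≤ _ := mul_le_mul_of_nonneg_right (cardioid_coeff_sum_le hw hm h0 hs.le hs3 N)
              (Finset.sum_nonneg fun _ _ => by positivity)
    refine le_of_mul_le_mul_left ?_ hs
    linarith
  set G : ℝ → ℝ := fun s => T s * Real.exp (-(4 * s / 3 + s ^ 2 / 3)) with hG
  have hGd : ∀ s, HasDerivAt G ((T' s - (4 / 3 + 2 / 3 * s) * T s) *
      Real.exp (-(4 * s / 3 + s ^ 2 / 3))) s := by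
    intro s
    have h1 : HasDerivAt (fun s : ℝ => -(4 * s / 3 + s ^ 2 / 3)) (-(4 / 3 + 2 / 3 * s)) s := by
      have := ((((hasDerivAt_id s).const_mul 4).div_const 3).add
        ((hasDerivAt_pow 2 s).div_const 3)).neg
      refine this.congr_deriv ?_
      norm_num; ring
    refine ((hd s).mul h1.exp).congr_deriv ?_
    ring
  have hanti : AntitoneOn G (Set.Icc 0 (1 / 3)) := by
    refine antitoneOn_of_deriv_nonpos (convex_Icc _ _)
      (fun s _ => (hGd s).continuousAt.continuousWithinAt)
      (fun s _ => (hGd s).differentiableAt.differentiableWithinAt) fun s hs => ?_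
    rw [interior_Icc] at hs
    rw [(hGd s).deriv]
    exact mul_nonpos_of_nonpos_of_nonneg (by linarith [hineq s hs.1 hs.2.le]) (Real.exp_pos _).le
  have hle := hanti (Set.left_mem_Icc.mpr (by norm_num)) (Set.mem_Icc.mpr ⟨ht0, ht⟩) ht0
  have hT0 : T 0 ≤ 1 := by
    rw [hT]
    rcases N with _ | N
    · simp
    · simp [Finset.sum_range_succ', taylorCoeff, hf1]
  have hG0 : G 0 ≤ 1 := by simpa [hG] using hT0
  have h := hle.trans hG0
  rw [hG] at h
  simp only [Real.exp_neg] at h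
  rwa [← div_eq_mul_inv, div_le_one (Real.exp_pos _)] at h

/-! ### Jack's lemma and subordination of the logarithm -/

/-- This contradicts a boundary point produced by Jack's lemma. If `q = w/v` had `|q| < 1`, then `v
(q² - m) = 2 (m - q)`, while `|q² - m| ≤ |m - q| + |q| |1 - q| ≤ (1 + |q|) |m - q| < 2 |m - q|`,
forcing `|v| > 1`. -/
theorem norm_le_of_cardioid_eq_real_mul {v w : ℂ} {m : ℝ} (hm : 1 ≤ m) (hv : ‖v‖ < 1)
    (h : w * (w + 2) = m * (v * (v + 2))) : ‖v‖ ≤ ‖w‖ := by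
  by_contra! hlt
  have hv0 : v ≠ 0 := by
    rintro rfl
    simp at hlt
    exact absurd hlt (not_lt.mpr (norm_nonneg w))
  set q := w / v with hq
  have hw : w = q * v := by rw [hq]; field_simp
  have hq1 : ‖q‖ < 1 := by
    rw [hq, norm_div, div_lt_one (norm_pos_iff.mpr hv0)]; exact hlt
  have h1 : v * (q ^ 2 - m) = 2 * (m - q) := by
    rw [hw] at h
    apply mul_left_cancel₀ hv0
    linear_combination h
  have hre : q.re < 1 := (Complex.re_le_norm q).trans_lt hq1
  have hpos : 0 < ‖1 - q‖ := norm_pos_iff.mpr fun h => by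
    have : q = 1 := (sub_eq_zero.mp h).symm
    simp [this] at hq1
  have h2 : ‖1 - q‖ ≤ ‖(m : ℂ) - q‖ := by
    rw [← sq_le_sq₀ (norm_nonneg _) (norm_nonneg _), Complex.sq_norm, Complex.sq_norm,
      Complex.normSq_apply, Complex.normSq_apply]
    simp
    nlinarith
  have h3 : ‖q ^ 2 - m‖ ≤ ‖(m : ℂ) - q‖ + ‖q‖ * ‖1 - q‖ := by
    have : q ^ 2 - m = -((m - q) + q * (1 - q)) := by ring
    rw [this, norm_neg]
    exact (norm_add_le _ _).trans_eq (by rw [norm_mul])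
  have h4 : ‖v‖ * ‖q ^ 2 - m‖ = 2 * ‖(m : ℂ) - q‖ := by
    rw [← norm_mul, h1, norm_mul]; simp
  nlinarith [norm_nonneg v, norm_nonneg (q ^ 2 - (m : ℂ)), norm_nonneg q]

theorem HasDerivAt.nonneg_of_forall_le_left {ρ : ℝ → ℝ} {d a : ℝ} (h : HasDerivAt ρ d a)
    (hle : ∀ᶠ t in nhdsWithin a (Set.Iio a), ρ t ≤ ρ a) : 0 ≤ d := by
  have h1 := (hasDerivWithinAt_iff_tendsto_slope' (s := Set.Iio a) (by simp)).mp
    h.hasDerivWithinAt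
  refine ge_of_tendsto h1 ?_
  filter_upwards [hle, self_mem_nhdsWithin] with t ht hta
  rw [slope_def_field]
  exact div_nonneg_of_nonpos (by linarith) (by have : t < a := hta; linarith)

open Complex in
/-- **Jack's lemma**. -/
theorem jack_lemma {v : ℂ → ℂ} {U : Set ℂ} (hU : IsOpen U) (hd : DifferentiableOn ℂ v U)
    (hv0 : v 0 = 0) {r : ℝ} (hr : 0 < r) (hsub : Metric.closedBall 0 r ⊆ U) {z₁ : ℂ}
    (hz₁ : z₁ ∈ Metric.closedBall 0 r) (hne : v z₁ ≠ 0) :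
    ∃ z₀ : ℂ, ‖z₀‖ = r ∧ ‖v z₁‖ ≤ ‖v z₀‖ ∧
      ∃ m : ℝ, 1 ≤ m ∧ z₀ * deriv v z₀ = m * v z₀ := by
  obtain ⟨z₀, hz₀, hmax⟩ := (isCompact_closedBall (0 : ℂ) r).exists_isMaxOn ⟨z₁, hz₁⟩
    (hd.continuousOn.mono hsub).norm
  have hmax' : ∀ z ∈ Metric.closedBall (0 : ℂ) r, ‖v z‖ ≤ ‖v z₀‖ := fun z hz => hmax hz
  set M := ‖v z₀‖ with hM
  have hMpos : 0 < M := (norm_pos_iff.mpr hne).trans_le (hmax' z₁ hz₁)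
  have hschwarz : ∀ z ∈ Metric.ball (0 : ℂ) r, ‖v z‖ ≤ M / r * ‖z‖ := by
    intro z hz
    have := Complex.dist_le_div_mul_dist_of_mapsTo_ball (f := v) (c := 0) (R₁ := r) (R₂ := M)
      (hd.mono (Metric.ball_subset_closedBall.trans hsub))
      (fun x hx => by simpa [hv0] using hmax' x (Metric.ball_subset_closedBall hx)) hz
    simpa [hv0] using this
  -- An interior maximum would give `M ≤ M ‖z₀‖ / r < M` by the Schwarz bound.
  have hnorm : ‖z₀‖ = r := by
    refine le_antisymm (by simpa using hz₀) ?_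
    by_contra! hlt
    have h1 := hschwarz z₀ (by simpa using hlt)
    rw [← hM, div_mul_eq_mul_div, le_div_iff₀ hr] at h1
    nlinarith
  have hder : HasDerivAt v (deriv v z₀) z₀ :=
    (hd.differentiableAt (hU.mem_nhds (hsub hz₀))).hasDerivAt
  have hin : ∀ d : ℂ, inner ℝ (v z₀) d = ((starRingEnd ℂ) (v z₀) * d).re := fun d => by
    rw [Complex.inner, mul_comm]
  set D := z₀ * deriv v z₀ with hD
  -- the tangential derivative of `‖v‖ ^ 2` vanishes
  have him : ((starRingEnd ℂ) (v z₀) * D).im = 0 := by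
    have hc : HasDerivAt (fun θ : ℝ => z₀ * exp (θ * I)) (z₀ * I) 0 := by
      have h1 : HasDerivAt (fun θ : ℂ => z₀ * exp (θ * I)) (z₀ * I) ((0 : ℝ) : ℂ) := by
        have := (((hasDerivAt_id ((0 : ℝ) : ℂ)).mul_const I).cexp).const_mul z₀
        simpa using this
      exact h1.comp_ofReal
    have h2 : HasDerivAt (fun θ : ℝ => v (z₀ * exp (θ * I))) (deriv v z₀ * (z₀ * I)) 0 := by
      have hder' : HasDerivAt v (deriv v z₀) (z₀ * exp ((0 : ℝ) * I)) := by simpa using hder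
      exact hder'.comp (0 : ℝ) hc
    have h3 := h2.norm_sq
    have hloc : IsLocalMax (fun θ : ℝ => ‖v (z₀ * exp (θ * I))‖ ^ 2) 0 := by
      refine Filter.Eventually.of_forall fun θ => ?_
      have h4 := hmax' (z₀ * exp (θ * I)) (by
        simp [norm_exp_ofReal_mul_I, hnorm])
      simp only [ofReal_zero, zero_mul, exp_zero, mul_one]
      gcongr
    have h5 := hloc.hasDerivAt_eq_zero h3
    simp only [ofReal_zero, zero_mul, exp_zero, mul_one, hin] at h5
    have h6 : (starRingEnd ℂ) (v z₀) * (deriv v z₀ * (z₀ * I)) =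
        ((starRingEnd ℂ) (v z₀) * D) * I := by rw [hD]; ring
    rw [h6, mul_I_re] at h5
    linarith
  -- the radial derivative dominates that of `M t`
  have hre : M ^ 2 ≤ ((starRingEnd ℂ) (v z₀) * D).re := by
    have hc : HasDerivAt (fun t : ℝ => (t : ℂ) * z₀) z₀ 1 := by
      have h1 : HasDerivAt (fun t : ℂ => t * z₀) z₀ ((1 : ℝ) : ℂ) := by
        simpa using (hasDerivAt_id ((1 : ℝ) : ℂ)).mul_const z₀
      exact h1.comp_ofReal
    have h2 : HasDerivAt (fun t : ℝ => v (t * z₀)) (deriv v z₀ * z₀) 1 := by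
      have hder' : HasDerivAt v (deriv v z₀) (((1 : ℝ) : ℂ) * z₀) := by simpa using hder
      exact hder'.comp (1 : ℝ) hc
    have h3 := h2.norm_sq.sub ((hasDerivAt_pow 2 (1 : ℝ)).const_mul (M ^ 2))
    have h4 := h3.nonneg_of_forall_le_left (by
      filter_upwards [Ioo_mem_nhdsLT (zero_lt_one' ℝ)] with t ht
      have h5 := hschwarz (t * z₀) (by
        simp [hnorm, abs_of_pos ht.1]; nlinarith [ht.2])
      rw [norm_mul, hnorm, norm_real, Real.norm_of_nonneg ht.1.le] at h5
      have h6 : M / r * (t * r) = M * t := by field_simp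
      rw [h6] at h5
      have h7 := pow_le_pow_left₀ (norm_nonneg _) h5 2
      simp only [Pi.sub_apply, ofReal_one, one_mul, one_pow, mul_one, ← hM]
      linarith [mul_pow M t 2])
    simp only [ofReal_one, one_mul, hin] at h4
    have h8 : (starRingEnd ℂ) (v z₀) * (deriv v z₀ * z₀) = (starRingEnd ℂ) (v z₀) * D := by
      rw [hD]; ring
    rw [h8] at h4
    push_cast at h4
    linarith
  refine ⟨z₀, hnorm, hmax' z₁ hz₁, ((starRingEnd ℂ) (v z₀) * D).re / M ^ 2, ?_, ?_⟩
  · rwa [le_div_iff₀ (by positivity), one_mul]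
  · have h1 : (((starRingEnd ℂ) (v z₀) * D).re : ℂ) = (starRingEnd ℂ) (v z₀) * D := by
      apply Complex.ext <;> simp [him]
    have h2 : (starRingEnd ℂ) (v z₀) * v z₀ = (M : ℂ) ^ 2 := by
      rw [mul_comm, Complex.mul_conj, Complex.normSq_eq_norm_sq]; push_cast; rfl
    have hMc : (M : ℂ) ≠ 0 := by exact_mod_cast hMpos.ne'
    push_cast
    rw [h1]
    field_simp
    linear_combination (-D) * h2

open Complex in
theorem add_two_sq_re_pos {w : ℂ} (hw : ‖w‖ < 1) : 0 < ((w + 2) ^ 2).re := by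
  have h1 := (abs_lt.mp ((abs_re_le_norm w).trans_lt hw)).1
  have h2 := abs_lt.mp ((abs_im_le_norm w).trans_lt hw)
  simp [pow_two]
  nlinarith [h2.1, h2.2]

open Complex in
theorem cpow_half_add_two_sq {w : ℂ} (hw : ‖w‖ < 1) : ((w + 2) ^ 2) ^ (1 / 2 : ℂ) = w + 2 := by
  have h1 := (abs_lt.mp ((abs_re_le_norm w).trans_lt hw)).1
  have h2 : 0 < (w + 2).re := by simp; linarith
  have h3 := abs_lt.mp (abs_arg_lt_pi_div_two_iff.mpr (Or.inl h2))
  have := pow_cpow_nat_inv (n := 2) (x := w + 2) (by norm_num) (by push_cast; linarith [h3.1])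
    (by push_cast; linarith [h3.2])
  simpa using this

open Complex Metric in
/-- If `z g'(z) = 4ω/3 + 2ω²/3` then `g` is subordinate to the convex function `4w/3 + w²/3`. -/
theorem exists_norm_le_add_two_sq {g w : ℂ → ℂ} (hg : DifferentiableOn ℂ g (ball 0 1))
    (hg0 : g 0 = 0) (hw : ∀ z ∈ ball (0 : ℂ) 1, ‖w z‖ ≤ ‖z‖)
    (heq : ∀ z ∈ ball (0 : ℂ) 1, z * deriv g z = 4 / 3 * w z + 2 / 3 * (w z * w z))
    {z : ℂ} (hz : z ∈ ball (0 : ℂ) 1) :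
    ∃ u : ℂ, ‖u‖ ≤ ‖z‖ ∧ 3 * g z + 4 = (u + 2) ^ 2 := by
  -- Completing the square, `4u/3 + u²/3 = ((u + 2)² - 4)/3`, so `v` is the candidate for `u`. The
  -- principal root is the right branch wherever some `u` with `|u| < 1` exists.
  set v : ℂ → ℂ := fun z => (3 * g z + 4) ^ (1 / 2 : ℂ) - 2 with hv
  have hvsq : ∀ z, (v z + 2) ^ 2 = 3 * g z + 4 := by
    intro z
    simp [hv]
  have hv_of : ∀ {z u : ℂ}, ‖u‖ < 1 → 3 * g z + 4 = (u + 2) ^ 2 → v z = u := by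
    intro z u hu h
    rw [hv]; simp only [h, cpow_half_add_two_sq hu]; ring
  have hv0 : v 0 = 0 := hv_of (by simp) (by rw [hg0]; norm_num)
  suffices h : ‖v z‖ ≤ ‖z‖ from ⟨v z, h, (hvsq z).symm⟩
  by_contra! hbad
  -- `R` is the infimum of the radii at which `‖v z‖ ≤ ‖z‖` fails.
  set B := {z : ℂ | z ∈ ball (0 : ℂ) 1 ∧ ‖z‖ < ‖v z‖} with hB
  set R := sInf (norm '' B) with hR
  have hbdd : BddBelow (norm '' B) := ⟨0, by rintro _ ⟨x, _, rfl⟩; exact norm_nonneg x⟩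
  have hnonempty : (norm '' B).Nonempty := ⟨_, z, ⟨hz, hbad⟩, rfl⟩
  have hR0 : 0 ≤ R := le_csInf hnonempty (by rintro _ ⟨x, _, rfl⟩; exact norm_nonneg x)
  have hR1 : R < 1 := (csInf_le hbdd ⟨z, ⟨hz, hbad⟩, rfl⟩).trans_lt (by simpa using hz)
  have hgood : ∀ x ∈ ball (0 : ℂ) R, ‖v x‖ ≤ ‖x‖ := by
    intro x hx
    by_contra! h
    have hx' : ‖x‖ < R := by simpa using hx
    have : R ≤ ‖x‖ := csInf_le hbdd ⟨x, ⟨by simpa using hx'.trans hR1, h⟩, rfl⟩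
    linarith
  have hcont : ContinuousOn (fun z => 3 * g z + 4) (ball 0 1) :=
    (hg.continuousOn.const_smul (3 : ℂ)).add continuousOn_const
  -- The bound passes to `|x| = R` by compactness of the image of `closedBall 0 R`, before
  -- continuity of `v` there is known.
  have hclosed : ∀ x ∈ closedBall (0 : ℂ) R, ∃ u : ℂ, ‖u‖ ≤ R ∧ 3 * g x + 4 = (u + 2) ^ 2 := by
    intro x hx
    rcases hR0.eq_or_lt with h0 | h0
    · have : x = 0 := by rw [← h0] at hx; simpa using hx
      exact ⟨0, by simp [← h0], by rw [this, hg0]; norm_num⟩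
    · have hK : IsCompact ((fun u : ℂ => (u + 2) ^ 2) '' closedBall 0 R) :=
        (isCompact_closedBall _ _).image (by fun_prop)
      have hx1 : x ∈ ball (0 : ℂ) 1 := closedBall_subset_ball hR1 hx
      have hmem := ContinuousWithinAt.mem_closure (s := ball (0 : ℂ) R)
        (t := (fun u : ℂ => (u + 2) ^ 2) '' closedBall 0 R)
        ((hcont.continuousAt (isOpen_ball.mem_nhds hx1)).continuousWithinAt)
        (by rwa [closure_ball _ h0.ne'])
        (fun y hy => ⟨v y, by
          have h1 := hgood y hy
          have h2 : ‖y‖ < R := by simpa using hy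
          simpa using h1.trans h2.le, hvsq y⟩)
      rw [hK.isClosed.closure_eq] at hmem
      obtain ⟨u, hu, h⟩ := hmem
      exact ⟨u, by simpa using hu, h.symm⟩
  set O₁ := ball (0 : ℂ) 1 ∩ (fun z => 3 * g z + 4) ⁻¹' slitPlane with hO₁
  have hO₁o : IsOpen O₁ := hcont.isOpen_inter_preimage isOpen_ball isOpen_slitPlane
  have hvd : DifferentiableOn ℂ v O₁ := by
    refine DifferentiableOn.sub_const (DifferentiableOn.cpow_const ?_ fun x hx => hx.2) 2
    exact ((hg.mono Set.inter_subset_left).const_mul 3).add_const 4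
  have hOo : IsOpen (O₁ ∩ v ⁻¹' ball 0 1) := hvd.continuousOn.isOpen_inter_preimage hO₁o isOpen_ball
  have hsub : closedBall (0 : ℂ) R ⊆ O₁ ∩ v ⁻¹' ball 0 1 := by
    intro x hx
    obtain ⟨u, hu, h⟩ := hclosed x hx
    refine ⟨⟨closedBall_subset_ball hR1 hx, ?_⟩, ?_⟩
    · show 3 * g x + 4 ∈ slitPlane
      rw [h]; exact Or.inl (add_two_sq_re_pos (hu.trans_lt hR1))
    · show v x ∈ ball 0 1
      rw [hv_of (hu.trans_lt hR1) h]; simpa using hu.trans_lt hR1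
  -- There is room beyond `R` where `v` is still holomorphic with `|v| < 1`. A bad point `z₁` lies
  -- in that room, and Jack's lemma is applied on its circle.
  obtain ⟨δ, hδ, hth⟩ := (isCompact_closedBall (0 : ℂ) R).exists_thickening_subset_open hOo hsub
  rw [thickening_closedBall hδ hR0] at hth
  obtain ⟨_, ⟨z₁, ⟨hz₁, hz₁v⟩, rfl⟩, hlt⟩ := exists_lt_of_csInf_lt hnonempty
    (show R < δ + R by linarith)
  have hz₁0 : 0 < ‖z₁‖ := norm_pos_iff.mpr fun h => by simp [h, hv0] at hz₁v
  have hsub₁ : closedBall (0 : ℂ) ‖z₁‖ ⊆ O₁ ∩ v ⁻¹' ball 0 1 :=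
    (closedBall_subset_ball hlt).trans hth
  obtain ⟨z₀, hz₀, hle, m, hm, hjack⟩ := jack_lemma hO₁o hvd hv0 hz₁0
    (hsub₁.trans Set.inter_subset_left) (z₁ := z₁) (by simp)
    (norm_pos_iff.mp ((norm_nonneg _).trans_lt hz₁v))
  have hz₀O := hsub₁ (show z₀ ∈ closedBall (0 : ℂ) ‖z₁‖ by simp [hz₀])
  have hz₀b : z₀ ∈ ball (0 : ℂ) 1 := hz₀O.1.1
  have hvder := (hvd.differentiableAt (hO₁o.mem_nhds hz₀O.1)).hasDerivAt
  have hgder := (hg.differentiableAt (isOpen_ball.mem_nhds hz₀b)).hasDerivAt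
  have hder : 2 * (v z₀ + 2) * deriv v z₀ = 3 * deriv g z₀ := by
    have h1 := (hvder.add_const 2).pow 2
    have h2 := (hgder.const_mul 3).add_const 4
    have h3 : (fun z => v z + 2) ^ 2 = fun z => 3 * g z + 4 := by ext z; simp [hvsq]
    rw [h3] at h1
    have := h1.unique h2
    simpa using this
  have h4 := heq z₀ hz₀b
  have h5 : w z₀ * (w z₀ + 2) = m * (v z₀ * (v z₀ + 2)) := by
    linear_combination (-3 / 2) * h4 - z₀ / 2 * hder + (v z₀ + 2) * hjack
  have h6 := norm_le_of_cardioid_eq_real_mul hm (by simpa using hz₀O.2) h5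
  have h7 := hw z₀ hz₀b
  linarith

/-! ### Lower growth bound and distance to the boundary -/

section CardioidGrowth

open Complex Metric

theorem cardioidClass_ode {f w : ℂ → ℂ} (hf : f ∈ classS)
    (h : ∀ z ∈ ball (0 : ℂ) 1, starlikeQuotient f z = 1 + 4 * w z / 3 + 2 * w z ^ 2 / 3) :
    ∀ z ∈ ball (0 : ℂ) 1, z * deriv f z = f z + (4 / 3 * w z + 2 / 3 * (w z * w z)) * f z := by
  intro z hz
  by_cases hz0 : z = 0
  · simp [hz0, hf.2.1]
  · have hfz : f z ≠ 0 := fun h0 =>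
      hz0 (hf.2.2.2 hz (mem_ball_self one_pos) (h0.trans hf.2.1.symm))
    have h1 := h z hz
    rw [starlikeQuotient, if_neg hz0, div_eq_iff hfz] at h1
    rw [h1]; ring

/-- A solution of `z f' = f + p f` is `z` times the exponential of a primitive of `p / z`. -/
theorem exists_eq_mul_exp {f p : ℂ → ℂ} (hf : DifferentiableOn ℂ f (ball 0 1)) (hf0 : f 0 = 0)
    (hf1 : deriv f 0 = 1) (hp : DifferentiableOn ℂ p (ball 0 1)) (hp0 : p 0 = 0)
    (h : ∀ z ∈ ball (0 : ℂ) 1, z * deriv f z = f z + p z * f z) :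
    ∃ g : ℂ → ℂ, DifferentiableOn ℂ g (ball 0 1) ∧ g 0 = 0 ∧
      (∀ z ∈ ball (0 : ℂ) 1, z * deriv g z = p z) ∧
      ∀ z ∈ ball (0 : ℂ) 1, f z = z * exp (g z) := by
  have hb : ball (0 : ℂ) 1 ∈ nhds 0 := ball_mem_nhds _ one_pos
  set q := dslope p 0
  have hq : DifferentiableOn ℂ q (ball 0 1) := (differentiableOn_dslope hb).mpr hp
  set F := dslope f 0 with hFdef
  have hF : DifferentiableOn ℂ F (ball 0 1) := (differentiableOn_dslope hb).mpr hf
  have hpq : ∀ z, p z = z * q z := fun z => by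
    simpa [hp0] using (sub_smul_dslope p 0 z).symm
  have hfF : f = fun z => z * F z := by
    ext z; simpa [hf0] using (sub_smul_dslope f 0 z).symm
  obtain ⟨g, hg0, hg⟩ := hq.isExactOn_ball.with_val_at 0 0
  have hFd : ∀ z ∈ ball (0 : ℂ) 1, HasDerivAt F (deriv F z) z := fun z hz =>
    (hF.differentiableAt (isOpen_ball.mem_nhds hz)).hasDerivAt
  have hne : ∀ z ∈ ball (0 : ℂ) 1, z ≠ 0 → deriv F z = q z * F z := by
    intro z hz hz0
    have h1 := h z hz
    have h2 : deriv f z = F z + z * deriv F z := by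
      have := (hasDerivAt_id' z).fun_mul (hFd z hz)
      rw [hfF, this.deriv, one_mul]
    rw [h2, hpq z, hfF] at h1
    have hz2 : z ^ 2 ≠ 0 := pow_ne_zero 2 hz0
    apply mul_left_cancel₀ hz2
    linear_combination h1
  -- Factors of `z` can be cancelled only off the origin; continuity of both sides recovers `F' = q
  -- F` at `0`.
  have hev : deriv F =ᶠ[nhds 0] fun z => q z * F z := by
    rw [← ContinuousAt.eventuallyEq_nhds_iff_eventuallyEq_nhdsNE]
    · filter_upwards [mem_nhdsWithin_of_mem_nhds hb, self_mem_nhdsWithin] with z hz hz0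
      exact hne z hz hz0
    · exact (hF.analyticAt hb).deriv.continuousAt
    · exact (hq.mul hF).continuousOn.continuousAt hb
  have hall : ∀ z ∈ ball (0 : ℂ) 1, deriv F z = q z * F z := by
    intro z hz
    by_cases hz0 : z = 0
    · rw [hz0]; exact hev.eq_of_nhds
    · exact hne z hz hz0
  have hGd : ∀ z ∈ ball (0 : ℂ) 1, HasDerivAt (fun z => F z * exp (-g z)) 0 z := by
    intro z hz
    refine ((hFd z hz).mul (hg z hz).neg.cexp).congr_deriv ?_
    rw [hall z hz]; ring
  have hF0 : F 0 = 1 := by rw [hFdef, dslope_same, hf1]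
  have hconst : ∀ z ∈ ball (0 : ℂ) 1, F z * exp (-g z) = 1 := by
    intro z hz
    have := isOpen_ball.is_const_of_deriv_eq_zero (convex_ball (0 : ℂ) 1).isPreconnected
      (f := fun z => F z * exp (-g z))
      (fun z hz => (hGd z hz).differentiableAt.differentiableWithinAt)
      (fun z hz => (hGd z hz).deriv) hz (mem_ball_self one_pos)
    simpa [hF0, hg0] using this
  refine ⟨g, fun z hz => (hg z hz).differentiableAt.differentiableWithinAt, hg0, ?_, ?_⟩
  · intro z hz
    rw [(hg z hz).deriv, hpq]
  · intro z hz
    have h1 := hconst z hz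
    rw [exp_neg, ← div_eq_mul_inv, div_eq_one_iff_eq (exp_ne_zero _)] at h1
    rw [hfF, ← h1]

/-- With `f = z exp g` and `3g + 4 = (u + 2)²`, where `u = x + iy` and `x² + y² ≤ 1`, one has `3 Re
g + 4 = (x + 2)² - y² ≥ 2(x + 1)² + 1 ≥ 1`, so `Re g ≥ -1`. -/
theorem norm_mul_exp_neg_one_le {f w : ℂ → ℂ} (hf : DifferentiableOn ℂ f (ball 0 1))
    (hf0 : f 0 = 0) (hf1 : deriv f 0 = 1) (hw : DifferentiableOn ℂ w (ball 0 1))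
    (hm : Set.MapsTo w (ball 0 1) (ball 0 1)) (h0 : w 0 = 0)
    (heq : ∀ z ∈ ball (0 : ℂ) 1,
      z * deriv f z = f z + (4 / 3 * w z + 2 / 3 * (w z * w z)) * f z)
    {z : ℂ} (hz : z ∈ ball (0 : ℂ) 1) : ‖z‖ * Real.exp (-1) ≤ ‖f z‖ := by
  obtain ⟨g, hg, hg0, hgd, hfg⟩ := exists_eq_mul_exp hf hf0 hf1
    (p := fun z => 4 / 3 * w z + 2 / 3 * (w z * w z))
    ((hw.const_mul _).add ((hw.mul hw).const_mul _)) (by simp [h0]) heq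
  have hschwarz : ∀ z ∈ ball (0 : ℂ) 1, ‖w z‖ ≤ ‖z‖ := fun z hz =>
    norm_le_norm_of_mapsTo_ball hw (hm.mono_right ball_subset_closedBall) h0 (by simpa using hz)
  obtain ⟨u, hu, h⟩ := exists_norm_le_add_two_sq hg hg0 hschwarz hgd hz
  rw [hfg z hz, norm_mul, norm_exp]
  gcongr
  have hu1 : ‖u‖ ^ 2 ≤ 1 := pow_le_one₀ (norm_nonneg _) (hu.trans (mem_ball_zero_iff.mp hz).le)
  rw [Complex.sq_norm, normSq_apply] at hu1
  have h2 := congrArg Complex.re h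
  simp [pow_two] at h2
  nlinarith [sq_nonneg (u.re + 1)]

/-- A frontier point `y` with `|y| < s < c` is a limit of values `f x` with `|x| ≤ s/c < 1`. By
compactness it is itself a value, which is impossible since the image is open. -/
theorem le_infEDist_frontier_image_ball {f : ℂ → ℂ} (hf : DifferentiableOn ℂ f (ball 0 1))
    (hf0 : f 0 = 0) (hinj : Set.InjOn f (ball 0 1)) {c : ℝ} (hc : 0 < c)
    (h : ∀ z ∈ ball (0 : ℂ) 1, ‖z‖ * c ≤ ‖f z‖) :
    ENNReal.ofReal c ≤ infEDist (f 0) (frontier (f '' ball 0 1)) := by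
  have hopen : IsOpen (f '' ball 0 1) := by
    rcases (hf.analyticOnNhd isOpen_ball).is_constant_or_isOpen (convex_ball _ _).isPreconnected
      with ⟨w, hw⟩ | hop
    · have h1 : (1 / 2 : ℂ) ∈ ball (0 : ℂ) 1 := by simp; norm_num
      have h2 := hinj h1 (mem_ball_self one_pos) ((hw _ h1).trans (hw 0 (mem_ball_self one_pos)).symm)
      norm_num at h2
    · exact hop _ subset_rfl isOpen_ball
  rw [le_infEDist]
  intro y hy
  rw [hopen.frontier_eq] at hy
  rw [hf0, edist_comm, edist_dist, dist_zero_right]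
  apply ENNReal.ofReal_le_ofReal
  by_contra! hlt
  apply hy.2
  obtain ⟨s, hs1, hs2⟩ := exists_between hlt
  have hs0 : 0 < s := (norm_nonneg y).trans_lt hs1
  have hK : IsCompact (f '' closedBall 0 (s / c)) :=
    (isCompact_closedBall _ _).image_of_continuousOn
      (hf.continuousOn.mono (closedBall_subset_ball ((div_lt_one hc).mpr hs2)))
  have hmem : y ∈ closure (f '' closedBall 0 (s / c)) := by
    have h1 : y ∈ closure (ball 0 s ∩ f '' ball 0 1) :=
      isOpen_ball.inter_closure ⟨by simpa using hs1, hy.1⟩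
    refine closure_mono ?_ h1
    rintro _ ⟨hxs, x, hx, rfl⟩
    refine ⟨x, ?_, rfl⟩
    have h2 := h x hx
    have h3 : ‖f x‖ < s := by simpa using hxs
    rw [mem_closedBall_zero_iff, le_div_iff₀ hc]
    linarith
  rw [hK.isClosed.closure_eq] at hmem
  exact Set.image_mono (closedBall_subset_ball ((div_lt_one hc).mpr hs2)) hmem

end CardioidGrowth

/-! ### The extremal function -/

section CardioidExtremal

open Complex Metric

/-- The extremal function `z exp (4z/3 + z²/3)` of the cardioid class. -/
noncomputable def cardioidExtremal (z : ℂ) : ℂ := z * exp (4 * z / 3 + z ^ 2 / 3)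

theorem hasDerivAt_cardioidExtremal (z : ℂ) :
    HasDerivAt cardioidExtremal
      ((1 + 4 * z / 3 + 2 * z ^ 2 / 3) * exp (4 * z / 3 + z ^ 2 / 3)) z := by
  have h1 : HasDerivAt (fun z : ℂ => 4 * z / 3 + z ^ 2 / 3) (4 / 3 + 2 * z / 3) z := by
    have := (((hasDerivAt_id z).const_mul 4).div_const 3).add ((hasDerivAt_pow 2 z).div_const 3)
    refine this.congr_deriv ?_
    norm_num
  refine ((hasDerivAt_id z).mul h1.cexp).congr_deriv ?_
  simp only [id]; ring

/-- Replacing `y²` by its strict bound `1 - x²` leaves `(2x + 1)²/3`. -/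
theorem re_cardioid_pos {z : ℂ} (hz : ‖z‖ < 1) : 0 < (1 + 4 * z / 3 + 2 * z ^ 2 / 3).re := by
  have h : ‖z‖ ^ 2 < 1 := pow_lt_one₀ (norm_nonneg _) hz two_ne_zero
  rw [Complex.sq_norm, normSq_apply] at h
  have h1 : (1 + 4 * z / 3 + 2 * z ^ 2 / 3).re = 1 + 4 * z.re / 3 + 2 * (z.re ^ 2 - z.im ^ 2) / 3 := by
    have e : 1 + 4 * z / 3 + 2 * z ^ 2 / 3 =
      ((1 + 4 * z.re / 3 + 2 * (z.re ^ 2 - z.im ^ 2) / 3 : ℝ) : ℂ) +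
      ((4 * z.im / 3 + 4 * z.re * z.im / 3 : ℝ) : ℂ) * I := by
      conv_lhs => rw [← re_add_im z]
      push_cast
      linear_combination (2 * z.im ^ 2 / 3 : ℂ) * I_sq
    rw [e]; simp [-ofReal_add, -ofReal_sub, -ofReal_mul, -ofReal_div]
  rw [h1]
  nlinarith [sq_nonneg (2 * z.re + 1)]

/-- The **Noshiro–Warschawski** criterion. -/
theorem injOn_of_re_deriv_pos {F F' : ℂ → ℂ} {s : Set ℂ} (hs : Convex ℝ s)
    (hd : ∀ z ∈ s, HasDerivAt F (F' z) z) (hpos : ∀ z ∈ s, 0 < (F' z).re) : Set.InjOn F s := by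
  intro a ha b hb hab
  by_contra hne
  set d := b - a with hdd
  have hd0 : d ≠ 0 := sub_ne_zero.mpr (Ne.symm hne)
  have hmem : ∀ t ∈ Set.Icc (0 : ℝ) 1, a + t * d ∈ s := by
    intro t ht
    have := hs.add_smul_sub_mem ha hb ht
    simpa [hdd] using this
  have hder : ∀ t ∈ Set.Icc (0 : ℝ) 1,
      HasDerivAt (fun t : ℝ => ((starRingEnd ℂ) d * F (a + t * d)).re)
        ((starRingEnd ℂ) d * (F' (a + t * d) * d)).re t := by
    intro t ht
    have h1 : HasDerivAt (fun t : ℂ => a + t * d) d (t : ℂ) := by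
      simpa using ((hasDerivAt_id (t : ℂ)).mul_const d).const_add a
    have h2 := ((hd _ (hmem t ht)).comp (t : ℂ) h1).const_mul ((starRingEnd ℂ) d)
    exact h2.real_of_complex
  have hmono : StrictMonoOn (fun t : ℝ => ((starRingEnd ℂ) d * F (a + t * d)).re)
      (Set.Icc 0 1) := by
    refine strictMonoOn_of_deriv_pos (convex_Icc _ _)
      (fun t ht => (hder t ht).continuousAt.continuousWithinAt) fun t ht => ?_
    rw [interior_Icc] at ht
    have ht' := Set.Ioo_subset_Icc_self ht
    rw [(hder t ht').deriv]
    have : (starRingEnd ℂ) d * (F' (a + t * d) * d) = ((normSq d : ℝ) : ℂ) * F' (a + t * d) := by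
      rw [← mul_conj]; ring
    rw [this, re_ofReal_mul]
    exact mul_pos (normSq_pos.mpr hd0) (hpos _ (hmem t ht'))
  have hlt := hmono (Set.left_mem_Icc.mpr zero_le_one) (Set.right_mem_Icc.mpr zero_le_one) one_pos
  simp [hdd, hab] at hlt

/-- In the coordinate `z = exp s` on the left half-plane, the logarithm of the function is `s + 4
exp s / 3 + exp(s)² / 3`. Its derivative `φ(exp s)` has positive real part, so it is injective.
Equal values at `z` and `w` give logarithms differing by `2πin`, which is absorbed by shifting `log
w`. -/
theorem injOn_cardioidExtremal : Set.InjOn cardioidExtremal (ball 0 1) := by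
  have hzero : ∀ z, cardioidExtremal z = 0 → z = 0 := fun z hz => by
    simpa [cardioidExtremal] using hz
  have hF : Set.InjOn (fun s : ℂ => s + (4 * exp s / 3 + exp s ^ 2 / 3)) {s | s.re < 0} := by
    refine injOn_of_re_deriv_pos (convex_halfSpace_re_lt 0)
      (F' := fun s => 1 + 4 * exp s / 3 + 2 * exp s ^ 2 / 3) (fun s _ => ?_) (fun s hs => ?_)
    · have h1 := (hasDerivAt_id s).add ((((hasDerivAt_exp s).const_mul 4).div_const 3).add
        (((hasDerivAt_exp s).pow 2).div_const 3))
      refine h1.congr_deriv ?_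
      norm_num; ring
    · apply re_cardioid_pos
      rw [norm_exp]
      exact Real.exp_lt_one_iff.mpr hs
  have hre : ∀ z ∈ ball (0 : ℂ) 1, z ≠ 0 → (log z).re < 0 := fun z hz h0 => by
    rw [log_re]; exact Real.log_neg (norm_pos_iff.mpr h0) (by simpa using hz)
  intro z hz w hw h
  by_cases hz0 : z = 0
  · rw [hz0] at h ⊢
    exact (hzero w (by rw [← h]; simp [cardioidExtremal])).symm
  have hw0 : w ≠ 0 := fun hw0 => hz0 (hzero z (by rw [h, hw0]; simp [cardioidExtremal]))
  have h1 : exp (log z + (4 * z / 3 + z ^ 2 / 3)) = exp (log w + (4 * w / 3 + w ^ 2 / 3)) := by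
    rw [exp_add (log z), exp_add (log w), exp_log hz0, exp_log hw0]; exact h
  obtain ⟨n, hn⟩ := exp_eq_exp_iff_exists_int.mp h1
  have hew : exp (log w + n * (2 * Real.pi * I)) = w := by
    rw [exp_periodic.int_mul n (log w), exp_log hw0]
  have h2 : log z = log w + n * (2 * Real.pi * I) := by
    refine hF (hre z hz hz0) ?_ ?_
    · show (log w + n * (2 * Real.pi * I)).re < 0
      have := hre w hw hw0
      simpa using this
    · simp only [hew, exp_log hz0]
      rw [hn]; ring
  rw [← exp_log hz0, h2, hew]

theorem cardioidExtremal_mem : cardioidExtremal ∈ cardioidClass := by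
  refine ⟨⟨fun z _ => (hasDerivAt_cardioidExtremal z).differentiableAt.differentiableWithinAt,
    by simp [cardioidExtremal], ?_, injOn_cardioidExtremal⟩,
    fun z => z, differentiableOn_id, fun z hz => hz, rfl, fun z _ => ?_⟩
  · rw [(hasDerivAt_cardioidExtremal 0).deriv]; simp
  · unfold starlikeQuotient
    split_ifs with h
    · simp [h]
    · rw [(hasDerivAt_cardioidExtremal z).deriv, cardioidExtremal]
      have := exp_ne_zero (4 * z / 3 + z ^ 2 / 3)
      field_simp

theorem strictMonoOn_mul_exp :
    StrictMonoOn (fun x : ℝ => x * Real.exp (4 * x / 3 + x ^ 2 / 3)) (Set.Ici (-1)) := by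
  have hder : ∀ x : ℝ, HasDerivAt (fun x : ℝ => x * Real.exp (4 * x / 3 + x ^ 2 / 3))
      ((1 + 4 * x / 3 + 2 * x ^ 2 / 3) * Real.exp (4 * x / 3 + x ^ 2 / 3)) x := by
    intro x
    have h1 : HasDerivAt (fun x : ℝ => 4 * x / 3 + x ^ 2 / 3) (4 / 3 + 2 * x / 3) x := by
      have := (((hasDerivAt_id x).const_mul 4).div_const 3).add ((hasDerivAt_pow 2 x).div_const 3)
      refine this.congr_deriv ?_
      norm_num
    refine ((hasDerivAt_id x).mul h1.exp).congr_deriv ?_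
    simp only [id]; ring
  refine strictMonoOn_of_deriv_pos (convex_Ici _)
    (fun x _ => (hder x).continuousAt.continuousWithinAt) fun x _ => ?_
  rw [(hder x).deriv]
  exact mul_pos (by nlinarith [sq_nonneg (x + 1)]) (Real.exp_pos _)

theorem cardioidExtremal_ofReal (x : ℝ) :
    cardioidExtremal x = ((x * Real.exp (4 * x / 3 + x ^ 2 / 3) : ℝ) : ℂ) := by
  simp [cardioidExtremal]

theorem cardioidExtremal_neg_one : cardioidExtremal (-1) = ((-Real.exp (-1) : ℝ) : ℂ) := by
  have := cardioidExtremal_ofReal (-1)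
  push_cast at this
  rw [this]
  norm_num

/-- If the real value at `-1` were taken inside the disk, conjugation symmetry and injectivity would
make the preimage real, contradicting strict monotonicity on `[-1, ∞)`. -/
theorem cardioidExtremal_neg_one_mem_frontier :
    cardioidExtremal (-1) ∈ frontier (cardioidExtremal '' ball 0 1) := by
  have hcont : Continuous cardioidExtremal :=
    continuous_iff_continuousAt.mpr fun z => (hasDerivAt_cardioidExtremal z).continuousAt
  refine ⟨?_, fun hint => ?_⟩
  · refine image_closure_subset_closure_image hcont ⟨-1, ?_, rfl⟩
    rw [closure_ball _ one_ne_zero]; simp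
  · obtain ⟨z, hz, hzv⟩ := interior_subset hint
    have hconj : cardioidExtremal ((starRingEnd ℂ) z) = cardioidExtremal z := by
      have h1 : cardioidExtremal ((starRingEnd ℂ) z) = (starRingEnd ℂ) (cardioidExtremal z) := by
        simp [cardioidExtremal, ← exp_conj, map_ofNat]
      rw [h1, hzv, cardioidExtremal_neg_one, conj_ofReal]
    have hreal := injOn_cardioidExtremal (by simpa using hz) hz hconj
    obtain ⟨x, rfl⟩ := conj_eq_iff_real.mp hreal
    have hx : |x| < 1 := by simpa using hz
    have h2 : cardioidExtremal (-1) = cardioidExtremal ((-1 : ℝ) : ℂ) := by simp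
    rw [h2, cardioidExtremal_ofReal, cardioidExtremal_ofReal, ofReal_inj] at hzv
    have h3 := strictMonoOn_mul_exp.injOn (Set.mem_Ici.mpr (abs_lt.mp hx).1.le)
      (Set.mem_Ici.mpr le_rfl) hzv
    linarith [(abs_lt.mp hx).1]

end CardioidExtremal

/-! ### The Bohr sum, the radius and its sharpness -/

open Complex Metric in
theorem bohr_sum_eq {f : ℂ → ℂ} (hf1 : deriv f 0 = 1) (z : ℂ) :
    ‖z‖ₑ + ∑' n : ℕ, ‖taylorCoeff f (n + 2)‖ₑ * ‖z‖ₑ ^ (n + 2) =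
      ∑' n : ℕ, ‖taylorCoeff f (n + 1) * z ^ (n + 1)‖ₑ := by
  rw [tsum_eq_zero_add' (f := fun n => ‖taylorCoeff f (n + 1) * z ^ (n + 1)‖ₑ) ENNReal.summable]
  simp [enorm_mul, enorm_pow, taylorCoeff, hf1]

open Complex Metric in
theorem enorm_le_bohr_sum {f : ℂ → ℂ} (hf : DifferentiableOn ℂ f (ball 0 1)) (hf0 : f 0 = 0)
    (hf1 : deriv f 0 = 1) {z : ℂ} (hz : z ∈ ball (0 : ℂ) 1) :
    ‖f z‖ₑ ≤ ‖z‖ₑ + ∑' n : ℕ, ‖taylorCoeff f (n + 2)‖ₑ * ‖z‖ₑ ^ (n + 2) := by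
  rw [bohr_sum_eq hf1]
  have h1 : HasSum (fun n => taylorCoeff f n * z ^ n) (f z) := by
    refine (hasSum_taylorSeries_on_ball hf hz).congr_fun fun n => ?_
    simp [taylorCoeff]; ring
  have h2 := (hasSum_nat_add_iff' 1).mpr h1
  have h3 : f z - ∑ i ∈ Finset.range 1, taylorCoeff f i * z ^ i = f z := by
    simp [taylorCoeff, hf0]
  rw [h3] at h2
  rw [← h2.tsum_eq]
  exact enorm_tsum_le_tsum_enorm

theorem exists_root_mul_exp :
    ∃ r : ℝ, 0 < r ∧ r < 1 / 3 ∧ r * Real.exp (4 * r / 3 + r ^ 2 / 3) = Real.exp (-1) := by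
  have hcont : ContinuousOn (fun x : ℝ => x * Real.exp (4 * x / 3 + x ^ 2 / 3))
      (Set.Icc 0 (1 / 3)) := by fun_prop
  have hlt : Real.exp (-1) < 1 / 3 * Real.exp (4 * (1 / 3) / 3 + (1 / 3) ^ 2 / 3) := by
    -- At `1/3` the exponent is `13/27 = 40/27 - 1`, so the claim is `exp(40/27) > 3`; the quadratic
    -- Taylor bound already exceeds `3.5`.
    have h1 := Real.quadratic_le_exp_of_nonneg (x := 40 / 27) (by norm_num)
    have h2 : Real.exp (4 * (1 / 3) / 3 + (1 / 3) ^ 2 / 3) =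
        Real.exp (40 / 27) * Real.exp (-1) := by
      rw [← Real.exp_add]; norm_num
    rw [h2]
    nlinarith [Real.exp_pos (-1)]
  obtain ⟨r, hr, h⟩ := intermediate_value_Ioo (by norm_num) hcont
    (show Real.exp (-1) ∈ Set.Ioo _ _ from ⟨by simpa using Real.exp_pos _, hlt⟩)
  exact ⟨r, hr.1, hr.2, h⟩

open Complex Metric in
theorem bohrInequality_of_mem_cardioidClass {f : ℂ → ℂ} (hf : f ∈ cardioidClass) {z : ℂ}
    (hz : ‖z‖ ≤ 1 / 3)
    (hle : ‖z‖ * Real.exp (4 * ‖z‖ / 3 + ‖z‖ ^ 2 / 3) ≤ Real.exp (-1)) : BohrInequality f z := by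
  obtain ⟨hS, w, hw, hm, h0, hsub⟩ := hf
  have hode := cardioidClass_ode hS hsub
  obtain ⟨hd, hf0, hf1, hinj⟩ := hS
  have hdist := le_infEDist_frontier_image_ball hd hf0 hinj (Real.exp_pos (-1))
    fun z hz => norm_mul_exp_neg_one_le hd hf0 hf1 hw hm h0 hode hz
  refine le_trans ?_ hdist
  rw [bohr_sum_eq hf1]
  refine ENNReal.tsum_le_of_sum_range_le fun N => ?_
  have h1 : ∀ n, ‖taylorCoeff f (n + 1) * z ^ (n + 1)‖ₑ =
      ENNReal.ofReal (‖z‖ * (‖taylorCoeff f (n + 1)‖ * ‖z‖ ^ n)) := fun n => by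
    rw [← ofReal_norm, norm_mul, norm_pow]
    congr 1; ring
  simp_rw [h1]
  rw [← ENNReal.ofReal_sum_of_nonneg fun _ _ => by positivity, ← Finset.mul_sum]
  refine ENNReal.ofReal_le_ofReal (le_trans ?_ hle)
  exact mul_le_mul_of_nonneg_left
    (cardioid_coeff_majorant hd hf0 hf1 hw hm h0 hode (norm_nonneg z) hz N) (norm_nonneg z)

open Complex Metric in
theorem not_bohrInequality_cardioidExtremal {ρ : ℝ} (h0 : 0 < ρ) (h1 : ρ < 1)
    (hlt : Real.exp (-1) < ρ * Real.exp (4 * ρ / 3 + ρ ^ 2 / 3)) :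
    ¬ BohrInequality cardioidExtremal ρ := by
  obtain ⟨⟨hd, hf0, hf1, -⟩, -⟩ := cardioidExtremal_mem
  intro hB
  have hρ : (ρ : ℂ) ∈ ball (0 : ℂ) 1 := by simpa [abs_of_pos h0] using h1
  have h2 := ((enorm_le_bohr_sum hd hf0 hf1 hρ).trans hB).trans
    (infEDist_le_edist_of_mem cardioidExtremal_neg_one_mem_frontier)
  rw [hf0, edist_comm, edist_zero_right, enorm_le_iff_norm_le, cardioidExtremal_neg_one,
    cardioidExtremal_ofReal, norm_real, norm_real, norm_neg, Real.norm_of_nonneg (by positivity),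
    Real.norm_of_nonneg (by positivity)] at h2
  linarith

theorem corollary2p5 :
    ∃ rf : ℝ,
      IsLeast {r : ℝ | r ∈ Set.Ioo (0 : ℝ) 1 ∧
        r * Real.exp (4 * r / 3 + r ^ 2 / 3) = Real.exp (-1)} rf ∧
      0 < rf ∧ rf < 1 / 3 ∧
      (∀ f ∈ cardioidClass, ∀ z : ℂ, ‖z‖ ≤ rf → BohrInequality f z) ∧
      (∀ ρ : ℝ, rf < ρ → ρ < 1 →
        ∃ f ∈ cardioidClass, ∃ z : ℂ, ‖z‖ = ρ ∧ ¬ BohrInequality f z) := by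
  obtain ⟨rf, h0, h3, hrf⟩ := exists_root_mul_exp
  have hmem : ∀ {x : ℝ}, 0 ≤ x → x ∈ Set.Ici (-1 : ℝ) := fun hx =>
    Set.mem_Ici.mpr (by linarith)
  refine ⟨rf, ⟨⟨⟨h0, by linarith⟩, hrf⟩, ?_⟩, h0, h3, ?_, ?_⟩
  · rintro r ⟨hr, h⟩
    exact (strictMonoOn_mul_exp.injOn (hmem h0.le) (hmem hr.1.le) (hrf.trans h.symm)).le
  · intro f hf z hz
    refine bohrInequality_of_mem_cardioidClass hf (by linarith) ?_
    rw [← hrf]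
    exact strictMonoOn_mul_exp.monotoneOn (hmem (norm_nonneg z)) (hmem h0.le) hz
  · intro ρ hρ hρ1
    have hρ0 : 0 < ρ := h0.trans hρ
    refine ⟨cardioidExtremal, cardioidExtremal_mem, ρ, ?_, ?_⟩
    · rw [Complex.norm_real, Real.norm_of_nonneg hρ0.le]
    · refine not_bohrInequality_cardioidExtremal hρ0 hρ1 ?_
      rw [← hrf]
      exact strictMonoOn_mul_exp (hmem h0.le) (hmem hρ0.le) hρ
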